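/- Let $\mathscr E$ be a Hilbert $C^*$-module over a (not necessarily unital) $C^*$-algebra $\mathscr A$, and let $\mathcal L(\mathscr E)$ be the $C^*$-algebra of adjointable operators on $\mathscr E$. An operator $T\in\mathcal L(\mathscr E)$ is positive if $\langle x,Tx\rangle\ge 0$ for all $x\in\mathscr E$, and $S\le T$ means that $T-S$ is positive; $\mathscr R(T)$ and $\mathscr N(T)$ denote range and null space. A self-adjoint operator $T$ is nonsingular if $\overline{\mathscr R(T)}=\mathscr E$. A closed submodule $\mathscr M$ is orthogonally complemented if $\mathscr E=\mathscr M\oplus\mathscr M^\perp$. For $T\in\mathcal L(\mathscr E)$ with $\overline{\mathscr R(T^*)}$ orthogonally complemented, the Moore--Penrose inverse $T^\dagger$ is the (possibly unbounded) operator with domain $\mathscr R(T)\oplus\mathscr N(T^*)$ given by $T^\dagger(Tx+y)=x$ for $x\in\overline{\mathscr R(T^*)}$ and $y\in\mathscr N(T^*)$. Let $H,K\in\mathcal L(\mathscr E)$ be positive, let $H$ be nonsingular, and suppose that $\overline{\mathscr R(H^{1/2}KH^{1/2})}$ is orthogonally complemented in $\mathscr E$. Then the following assertions are equivalent: (i)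 the equation $XHX=K$ has a positive solution $X\in\mathcal L(\mathscr E)$; (ii) $\mathscr R\big((H^{1/2}KH^{1/2})^{1/2}\big)\subseteq\mathscr R(H^{1/2})$ and $\mathscr R\Big(\big((H^{1/2})^{\dagger}(H^{1/2}KH^{1/2})^{1/2}\big)^*\Big)\subseteq\mathscr R(H^{1/2})$; (iii) $\mathscr R\big((H^{1/2}KH^{1/2})^{1/4}\big)\subseteq\mathscr R(H^{1/2})$; (iv) $\mathscr R\big((H^{1/2}KH^{1/2})^{1/2}\big)\subseteq\mathscr R(H^{1/2})$ and $(H^{1/2}KH^{1/2})^{1/2}\le\lambda H$ for some scalar $\lambda>0$. Moreover, whenever $\mathscr R\big((H^{1/2}KH^{1/2})^{1/2}\big)\subseteq\mathscr R(H^{1/2})$, the operator $(H^{1/2})^{\dagger}(H^{1/2}KH^{1/2})^{1/2}$ is everywhere defined and belongs to $\mathcal L(\mathscr E)$, so that its adjoint in (ii) makes sense. -/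

import Mathlib

/-!
Hilbert C*-modules are Mathlib's `CStarModule A E` on a complete space `E`, over an arbitrary (possibly
non-unital) C*-algebra `A`.  Below: the C*-algebra `L(E)` of adjointable operators, its order,
orthogonal complements, and the (possibly unbounded) Moore-Penrose inverse.
-/

open scoped InnerProductSpace

set_option linter.unusedSectionVars false

noncomputable section

namespace HilbertModule

variable (A : Type*) {E : Type*} [NonUnitalCStarAlgebra A] [PartialOrder A] [StarOrderedRing A]
  [NormedAddCommGroup E] [NormedSpace ℂ E] [SMul A E] [CStarModule A E]

/-- `T` has an adjoint for the `A`-valued inner product. -/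
def HasAdjoint (T : E →L[ℂ] E) : Prop :=
  ∃ S : E → E, ∀ x y : E, ⟪T x, y⟫_A = ⟪x, S y⟫_A

variable {A} in
theorem ext_inner {x y : E} (h : ∀ z : E, ⟪z, x⟫_A = ⟪z, y⟫_A) : x = y := by
  rw [← sub_eq_zero, ← CStarModule.inner_self (A := A), CStarModule.inner_sub_right, h, sub_self]

variable {A} in
theorem norm_sq_eq' (x : E) : ‖x‖ * ‖x‖ = ‖⟪x, x⟫_A‖ := by
  rw [← CStarModule.norm_sq_eq A, sq]

variable {A} in
/-- An adjoint is automatically linear and bounded. -/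
theorem HasAdjoint.exists_clm {T : E →L[ℂ] E} (h : HasAdjoint A T) :
    ∃ S : E →L[ℂ] E, ‖S‖ ≤ ‖T‖ ∧ ∀ x y : E, ⟪T x, y⟫_A = ⟪x, S y⟫_A := by
  obtain ⟨S, hS⟩ := h
  refine ⟨LinearMap.mkContinuous ⟨⟨S, ?_⟩, ?_⟩ ‖T‖ ?_, LinearMap.mkContinuous_norm_le _ (norm_nonneg _) _,
    fun x y => hS x y⟩
  · intro x y
    refine ext_inner (A := A) fun z => ?_
    simp [← hS]
  · intro c x
    refine ext_inner (A := A) fun z => ?_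
    simp [← hS]
  · intro y
    change ‖S y‖ ≤ ‖T‖ * ‖y‖
    rcases eq_or_ne (‖S y‖) 0 with h0 | h0
    · rw [h0]; positivity
    · have h1 : ‖S y‖ * ‖S y‖ ≤ (‖T‖ * ‖y‖) * ‖S y‖ := by
        rw [norm_sq_eq' (A := A), ← hS]
        calc ‖⟪T (S y), y⟫_A‖ ≤ ‖T (S y)‖ * ‖y‖ := CStarModule.norm_inner_le E
          _ ≤ (‖T‖ * ‖S y‖) * ‖y‖ := by gcongr; exact T.le_opNorm _
          _ = _ := by ring
      exact le_of_mul_le_mul_right h1 (lt_of_le_of_ne (norm_nonneg _) (Ne.symm h0))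

variable (E) in
/-- The adjointable operators as a subalgebra of the bounded operators.  (Every map with an adjoint
on a complete module is automatically `ℂ`-linear and bounded.) -/
def adjointable : Subalgebra ℂ (E →L[ℂ] E) where
  carrier := {T | HasAdjoint A T}
  mul_mem' := by
    rintro T₁ T₂ ⟨S₁, h₁⟩ ⟨S₂, h₂⟩
    exact ⟨fun y => S₂ (S₁ y), fun x y => by simp [h₁, h₂]⟩
  add_mem' := by
    rintro T₁ T₂ ⟨S₁, h₁⟩ ⟨S₂, h₂⟩
    exact ⟨fun y => S₁ y + S₂ y, fun x y => by simp [h₁, h₂]⟩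
  algebraMap_mem' := fun c => ⟨fun y => star c • y, fun x y => by
    simp [Algebra.algebraMap_eq_smul_one]⟩

variable (E) in
/-- `L(E)`, the algebra of adjointable operators on `E`, with the operator norm. -/
abbrev L : Type _ := ↥(adjointable A E)

variable {A}

theorem exists_adjoint (T : L A E) :
    ∃ S : L A E, ‖S‖ ≤ ‖T‖ ∧ ∀ x y : E, ⟪T.1 x, y⟫_A = ⟪x, S.1 y⟫_A := by
  obtain ⟨S, hn, hS⟩ := HasAdjoint.exists_clm T.2
  refine ⟨⟨S, T.1, fun x y => ?_⟩, hn, hS⟩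
  rw [← CStarModule.star_inner, ← hS, CStarModule.star_inner]

/-- The adjoint `T*`. -/
instance : Star (L A E) := ⟨fun T => (exists_adjoint T).choose⟩

theorem inner_star (T : L A E) (x y : E) : ⟪T.1 x, y⟫_A = ⟪x, (star T).1 y⟫_A :=
  (exists_adjoint T).choose_spec.2 x y

theorem norm_star_le (T : L A E) : ‖star T‖ ≤ ‖T‖ := (exists_adjoint T).choose_spec.1

theorem L_ext {S T : L A E} (h : ∀ x y : E, ⟪x, S.1 y⟫_A = ⟪x, T.1 y⟫_A) : S = T :=
  Subtype.ext (ContinuousLinearMap.ext fun y => ext_inner (A := A) fun x => h x y)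

theorem inner_star_left (T : L A E) (x y : E) : ⟪(star T).1 x, y⟫_A = ⟪x, T.1 y⟫_A := by
  rw [← CStarModule.star_inner, ← inner_star, CStarModule.star_inner]

instance : StarRing (L A E) where
  star_involutive T := L_ext fun x y => by rw [← inner_star, inner_star_left]
  star_mul S T := L_ext fun x y => by
    rw [← inner_star]
    change ⟪S.1 (T.1 x), y⟫_A = ⟪x, (star T).1 ((star S).1 y)⟫_A
    rw [inner_star, inner_star]
  star_add S T := L_ext fun x y => by
    rw [← inner_star]
    change ⟪S.1 x + T.1 x, y⟫_A = ⟪x, (star S).1 y + (star T).1 y⟫_A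
    rw [CStarModule.inner_add_left, CStarModule.inner_add_right, inner_star, inner_star]

instance : StarModule ℂ (L A E) where
  star_smul c T := L_ext fun x y => by
    rw [← inner_star]
    change ⟪c • T.1 x, y⟫_A = ⟪x, star c • (star T).1 y⟫_A
    rw [CStarModule.inner_smul_left_complex, CStarModule.inner_smul_right_complex, inner_star]

theorem norm_star_eq (T : L A E) : ‖star T‖ = ‖T‖ :=
  le_antisymm (norm_star_le T) (by simpa using norm_star_le (star T))

instance : CStarRing (L A E) where
  norm_mul_self_le T := by
    have h : ‖T‖ ≤ √‖star T * T‖ := by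
      refine ContinuousLinearMap.opNorm_le_bound T.1 (Real.sqrt_nonneg _) fun x => ?_
      refine abs_le_of_sq_le_sq' ?_ (by positivity) |>.2
      have hs : √‖star T * T‖ ^ 2 = ‖star T * T‖ := Real.sq_sqrt (norm_nonneg _)
      rw [mul_pow, hs, sq, norm_sq_eq' (A := A), inner_star]
      calc ‖⟪x, (star T * T).1 x⟫_A‖ ≤ ‖x‖ * ‖(star T * T).1 x‖ := CStarModule.norm_inner_le E
        _ ≤ ‖x‖ * (‖star T * T‖ * ‖x‖) := by
          gcongr; exact (star T * T).1.le_opNorm x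
        _ = _ := by ring
    calc ‖T‖ * ‖T‖ ≤ √‖star T * T‖ * √‖star T * T‖ := by gcongr
      _ = _ := Real.mul_self_sqrt (norm_nonneg _)

theorem isClosed_adjointable [CompleteSpace E] :
    IsClosed (adjointable A E : Set (E →L[ℂ] E)) := by
  refine isClosed_of_closure_subset fun T hT => ?_
  obtain ⟨u, hu, hlim⟩ := mem_closure_iff_seq_limit.1 hT
  let v : ℕ → L A E := fun n => ⟨u n, hu n⟩
  have hc : CauchySeq fun n => (star (v n)).1 := by
    rw [Metric.cauchySeq_iff']
    intro ε hε
    obtain ⟨N, hN⟩ := Metric.cauchySeq_iff'.1 hlim.cauchySeq ε hε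
    refine ⟨N, fun n hn => ?_⟩
    have h1 : dist (star (v n)).1 (star (v N)).1 = ‖star (v n - v N)‖ := by
      rw [star_sub, dist_eq_norm]; rfl
    rw [h1, norm_star_eq]
    have := hN n hn
    rwa [dist_eq_norm] at this
  obtain ⟨S, hS⟩ := cauchySeq_tendsto_of_complete hc
  refine ⟨S, fun x y => ?_⟩
  have hT1 : Filter.Tendsto (fun n => ⟪u n x, y⟫_A) Filter.atTop (nhds ⟪T x, y⟫_A) :=
    (CStarModule.continuous_inner (A := A) (E := E)).continuousAt.tendsto.comp
      ((((ContinuousLinearMap.apply ℂ E x).continuous.tendsto T).comp hlim).prodMk_nhds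
        tendsto_const_nhds)
  have hS1 : Filter.Tendsto (fun n => ⟪x, (star (v n)).1 y⟫_A) Filter.atTop (nhds ⟪x, S y⟫_A) :=
    (CStarModule.continuous_inner (A := A) (E := E)).continuousAt.tendsto.comp
      (tendsto_const_nhds.prodMk_nhds
        (((ContinuousLinearMap.apply ℂ E y).continuous.tendsto S).comp hS))
  refine tendsto_nhds_unique hT1 (hS1.congr fun n => ?_)
  rw [← inner_star]

instance [CompleteSpace E] : CompleteSpace (L A E) :=
  (isClosed_adjointable (A := A) (E := E)).completeSpace_coe

/-- `L(E)` is a unital C*-algebra. -/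
instance [CompleteSpace E] : CStarAlgebra (L A E) where

/-! ### Positivity -/

/-- `T` is positive: `⟨x, T x⟩ ≥ 0` for all `x`. -/
def IsPos (T : L A E) : Prop := ∀ x : E, 0 ≤ ⟪x, T.1 x⟫_A

theorem IsPos.isSelfAdjoint {T : L A E} (h : IsPos T) : IsSelfAdjoint T := by
  have hs : ∀ x : E, ⟪x, (star T - T).1 x⟫_A = 0 := fun x => by
    change ⟪x, (star T).1 x - T.1 x⟫_A = 0
    rw [CStarModule.inner_sub_right, ← inner_star, ← CStarModule.star_inner, sub_eq_zero]
    exact (IsSelfAdjoint.of_nonneg (h x)).star_eq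
  exact sub_eq_zero.1 (quad_zero hs)
where
  /-- polarization -/
  quad_zero {R : L A E} (h : ∀ x : E, ⟪x, R.1 x⟫_A = 0) : R = 0 := by
    refine L_ext fun x y => ?_
    have h1 := h (x + y)
    have h2 := h (x + Complex.I • y)
    simp only [map_add, map_smul, CStarModule.inner_add_left, CStarModule.inner_add_right,
      CStarModule.inner_smul_left_complex, CStarModule.inner_smul_right_complex, h, zero_add,
      add_zero, smul_zero] at h1 h2
    have h3 : ⟪y, R.1 x⟫_A = -⟪x, R.1 y⟫_A := eq_neg_of_add_eq_zero_left (by rwa [add_comm] at h1 ⊢)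
    rw [h3] at h2
    have h4 : (2 * Complex.I) • ⟪x, R.1 y⟫_A = 0 := by
      rw [← h2]; simp [two_mul, add_smul]
    have h5 := (smul_eq_zero.1 h4).resolve_left (by simp)
    rw [h5]
    simp

/-- The order of `L(E)`: `S ≤ T` iff `T - S` is positive. -/
instance : PartialOrder (L A E) where
  le S T := IsPos (T - S)
  le_refl T := fun x => by simp
  le_trans R S T h₁ h₂ := fun x => by
    have h : T - R = (T - S) + (S - R) := by abel
    rw [h]
    change 0 ≤ ⟪x, (T - S).1 x + (S - R).1 x⟫_A
    rw [CStarModule.inner_add_right]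
    exact add_nonneg (h₂ x) (h₁ x)
  le_antisymm S T h₁ h₂ := by
    refine (sub_eq_zero.1 (IsPos.isSelfAdjoint.quad_zero (R := T - S) fun x => ?_)).symm
    refine le_antisymm ?_ (h₁ x)
    have h : S - T = -(T - S) := by abel
    have h3 := h₂ x
    rw [h] at h3
    change 0 ≤ ⟪x, -((T - S).1 x)⟫_A at h3
    rwa [CStarModule.inner_neg_right, Left.nonneg_neg_iff] at h3

theorem le_def {S T : L A E} : S ≤ T ↔ ∀ x : E, 0 ≤ ⟪x, (T - S).1 x⟫_A := Iff.rfl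

theorem nonneg_def {T : L A E} : 0 ≤ T ↔ ∀ x : E, 0 ≤ ⟪x, T.1 x⟫_A := by
  rw [le_def, sub_zero]

theorem exists_star_mul_self [CompleteSpace E] {T : L A E} (h : IsPos T) :
    ∃ s : L A E, T = star s * s := by
  have hsa : IsSelfAdjoint T := h.isSelfAdjoint
  let f : ℝ → ℝ := fun t => max (-t) 0
  let g : ℝ → ℝ := fun t => max (-t) 0 * √(max (-t) 0)
  have hf : Continuous f := by fun_prop
  have hg : Continuous g := by fun_prop
  have hq : IsSelfAdjoint (cfc f T) := cfc_predicate f T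
  have hn : IsSelfAdjoint (cfc g T) := cfc_predicate g T
  have key : cfc f T * T * cfc f T = -(cfc g T * cfc g T) := by
    nth_rewrite 2 [← cfc_id' ℝ T]
    rw [← cfc_mul f (fun t => t) T, ← cfc_mul _ f T, ← cfc_mul g g T, ← cfc_neg]
    refine cfc_congr fun t _ => ?_
    change f t * t * f t = -(g t * g t)
    rcases le_total t 0 with ht | ht
    · have : max (-t) 0 = -t := max_eq_left (by linarith)
      simp only [f, g, this]
      rw [show (-t * √(-t)) * (-t * √(-t)) = t * t * (√(-t) * √(-t)) by ring,
        Real.mul_self_sqrt (by linarith)]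
      ring
    · have : max (-t) 0 = 0 := max_eq_right (by linarith)
      simp [f, g, this]
  have hn0 : cfc g T = 0 := by
    refine Subtype.ext (ContinuousLinearMap.ext fun x => ?_)
    change (cfc g T).1 x = 0
    rw [← CStarModule.inner_self (A := A)]
    refine le_antisymm ?_ CStarModule.inner_self_nonneg
    have h1 := h ((cfc f T).1 x)
    rw [inner_star, hq.star_eq] at h1
    have h2 : (cfc f T).1 (T.1 ((cfc f T).1 x)) = -((cfc g T).1 ((cfc g T).1 x)) :=
      congrArg (fun R : L A E => R.1 x) key
    rw [h2, CStarModule.inner_neg_right, Left.nonneg_neg_iff] at h1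
    rwa [inner_star, hn.star_eq]
  have hspec : ∀ t ∈ spectrum ℝ T, 0 ≤ t := by
    intro t ht
    have h0 : cfc g T = cfc (fun _ => (0 : ℝ)) T := by rw [hn0]; simp
    have h1 : g t = 0 := (eqOn_of_cfc_eq_cfc h0 : _) ht
    by_contra hlt
    have h2 : max (-t) 0 = -t := max_eq_left (by linarith)
    have h3 : 0 < -t := by linarith
    have h4 : 0 < g t := by
      simp only [g, h2]
      positivity
    exact h4.ne' h1
  refine ⟨cfc Real.sqrt T, ?_⟩
  rw [(cfc_predicate Real.sqrt T : IsSelfAdjoint _).star_eq, ← cfc_mul Real.sqrt Real.sqrt T]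
  nth_rewrite 1 [← cfc_id' ℝ T]
  exact cfc_congr fun t ht => (Real.mul_self_sqrt (hspec t ht)).symm

/-- The positive operators are the positive elements of the C*-algebra `L(E)`; hence Mathlib's
powers `T ^ (r : ℝ)` of positive elements are available. -/
instance [CompleteSpace E] : StarOrderedRing (L A E) :=
  StarOrderedRing.of_nonneg_iff'
    (fun {S T} h R => by
      rw [le_def] at h ⊢
      rwa [add_sub_add_left_eq_sub])
    (fun T => ⟨fun h => exists_star_mul_self (nonneg_def.1 h), by
      rintro ⟨s, rfl⟩
      refine nonneg_def.2 fun x => ?_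
      change 0 ≤ ⟪x, (star s).1 (s.1 x)⟫_A
      rw [← inner_star]
      exact CStarModule.inner_self_nonneg⟩)

/-! ### Ranges and orthogonal complements -/

/-- The range `R(T)`. -/
def range (T : L A E) : Submodule ℂ E := LinearMap.range (T.1 : E →ₗ[ℂ] E)

/-- The null space `N(T)`. -/
def null (T : L A E) : Submodule ℂ E := LinearMap.ker (T.1 : E →ₗ[ℂ] E)

/-- A self-adjoint operator is nonsingular if its range is dense. -/
def Nonsingular (T : L A E) : Prop := IsSelfAdjoint T ∧ (range T).topologicalClosure = ⊤

variable (A) in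
/-- The orthogonal complement `{x | ⟨x, y⟩ = 0 for all y ∈ M}`. -/
def orth (M : Submodule ℂ E) : Submodule ℂ E where
  carrier := {x | ∀ y ∈ M, ⟪x, y⟫_A = 0}
  add_mem' := fun {x x'} h h' y hy => by rw [CStarModule.inner_add_left, h y hy, h' y hy, add_zero]
  zero_mem' := fun y _ => CStarModule.inner_zero_left
  smul_mem' := fun c x h y hy => by rw [CStarModule.inner_smul_left_complex, h y hy, smul_zero]

variable (A) in
/-- `E = M ⊕ M^⊥`. -/
def OrthComplemented (M : Submodule ℂ E) : Prop := IsCompl M (orth A M)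

/-! ### The Moore-Penrose inverse and adjoints of partially defined operators -/

/-- The graph of the Moore-Penrose inverse of `T`: the pairs `(T x + y, x)` with `x` in the closure
of `R(T*)` and `y ∈ N(T*)`. -/
def mpGraph (T : L A E) : Submodule ℂ (E × E) where
  carrier := {p | p.2 ∈ (range (star T)).topologicalClosure ∧ p.1 - T.1 p.2 ∈ null (star T)}
  add_mem' := fun {p q} hp hq => ⟨add_mem hp.1 hq.1, by
    have h := add_mem hp.2 hq.2
    simp only [Prod.fst_add, Prod.snd_add, map_add]
    convert h using 1
    abel⟩
  zero_mem' := ⟨zero_mem _, by simp⟩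
  smul_mem' := fun c p hp => ⟨Submodule.smul_mem _ c hp.1, by
    have h := Submodule.smul_mem _ c hp.2
    simpa [smul_sub] using h⟩

theorem mpGraph_functional (T : L A E) (p : E × E) (hp : p ∈ mpGraph T) (h0 : p.1 = 0) :
    p.2 = 0 := by
  obtain ⟨h1, h2⟩ := hp
  rw [h0, zero_sub] at h2
  have h3 : (star T).1 (T.1 p.2) = 0 := by
    have : (star T).1 (-(T.1 p.2)) = 0 := h2
    simpa using this
  have h4 : T.1 p.2 = 0 := by
    rw [← CStarModule.inner_self (A := A), inner_star, h3, CStarModule.inner_zero_right]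
  have h5 : IsClosed {z : E | ⟪p.2, z⟫_A = 0} :=
    isClosed_eq ((CStarModule.continuous_inner (A := A) (E := E)).comp
      (continuous_const.prodMk continuous_id)) continuous_const
  have h6 : ((range (star T) : Submodule ℂ E) : Set E) ⊆ {z : E | ⟪p.2, z⟫_A = 0} := by
    rintro _ ⟨w, rfl⟩
    change ⟪p.2, (star T).1 w⟫_A = 0
    rw [← inner_star, h4, CStarModule.inner_zero_left]
  have h7 : ⟪p.2, p.2⟫_A = 0 := closure_minimal h6 h5 h1
  exact CStarModule.inner_self.1 h7

/-- The Moore-Penrose inverse `T†` of an adjointable operator, as a partially defined, possibly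
unbounded operator: `T† (T x + y) = x` for `x` in the closure of `R(T*)` and `y ∈ N(T*)`.  If that
closure is orthogonally complemented, then its domain is `R(T) ⊕ N(T*)`. -/
def mpInv (T : L A E) : E →ₗ.[ℂ] E := (mpGraph T).toLinearPMap

theorem mpInv_graph (T : L A E) : (mpInv T).graph = mpGraph T :=
  Submodule.toLinearPMap_graph_eq _ (mpGraph_functional T)

/-- The product `F C` of a partially defined operator `F` and `C ∈ L(E)`, with its natural domain
`{x | C x ∈ dom F}`. -/
def pmul (F : E →ₗ.[ℂ] E) (C : L A E) : E →ₗ.[ℂ] E where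
  domain := F.domain.comap (C.1 : E →ₗ[ℂ] E)
  toFun := F.toFun ∘ₗ (C.1 : E →ₗ[ℂ] E).restrict fun _ hx => hx

/-- An element of `L(E)`, regarded as an everywhere defined operator. -/
def toPMap (T : L A E) : E →ₗ.[ℂ] E := (T.1 : E →ₗ[ℂ] E).toPMap ⊤

variable (A) in
/-- The graph of the adjoint `F*` of a partially defined operator: the pairs `(y, z)` with
`⟨F x, y⟩ = ⟨x, z⟩` for all `x ∈ dom F`. -/
def adjGraph (F : E →ₗ.[ℂ] E) : Submodule ℂ (E × E) where
  carrier := {p | ∀ x : F.domain, ⟪F x, p.1⟫_A = ⟪(x : E), p.2⟫_A}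
  add_mem' := fun {p q} hp hq x => by
    simp only [Prod.fst_add, Prod.snd_add, CStarModule.inner_add_right, hp x, hq x]
  zero_mem' := fun x => by simp
  smul_mem' := fun c p hp x => by
    simp only [Prod.smul_fst, Prod.smul_snd, CStarModule.inner_smul_right_complex, hp x]

variable (A) in
/-- The range `R(F*)` of the adjoint of a partially defined operator. -/
def adjRange (F : E →ₗ.[ℂ] E) : Submodule ℂ E := (adjGraph A F).map (LinearMap.snd ℂ E E)

end HilbertModule

end

open scoped InnerProductSpace

open Filter Topology

namespace HilbertModule

/-! ### Square and fourth roots of positive elements -/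

section Powers

variable {B : Type*} [CStarAlgebra B] [PartialOrder B] [StarOrderedRing B]

/-! Write `h` for the square root of `H`, `G = h * K * h`, `S` for the square root of `G` and `Q`
for that of `S`. Density of the range makes `h` cancellable on both sides, so by uniqueness of
positive square roots a positive `X` solves the equation iff `S = h * X * h`, and any such `X` is
positive by density. Everything is thus a factorization problem for `S`.

A solution gives `h† S = X h`, with adjoint `h X`, and `S ≤ ‖X‖ h²`. Conversely, `S = h D` with `D*
= h X` gives `S = S* = D* h = h X h`, and `Q = h C` gives `S = Q Q* = h (C C*) h`. The factors come
from `exists_mul_eq_of_range_le`, a Douglas lemma that needs no complementation because `h` is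
injective with dense range.

The hard implication is (iv) to (iii), `range_quarter_le`: with `S = h D`, the order bound gives `‖D
x‖ ≤ √c ‖Q x‖`, so `Q x ↦ D x` extends to the closure of the range of `Q`. On that closure `h`
composed with the extension is `Q`; on the complement of the closed range of `G`, `Q` vanishes. -/

theorem rpow_half_mul_self {a : B} (ha : 0 ≤ a) : a ^ (1 / 2 : ℝ) * a ^ (1 / 2 : ℝ) = a := by
  rw [← CFC.sqrt_eq_rpow, CFC.sqrt_mul_sqrt_self a ha]

theorem rpow_quarter_mul_self {a : B} (ha : 0 ≤ a) :
    a ^ (1 / 4 : ℝ) * a ^ (1 / 4 : ℝ) = a ^ (1 / 2 : ℝ) := by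
  have h : (a ^ (1 / 2 : ℝ)) ^ (1 / 2 : ℝ) = a ^ (1 / 4 : ℝ) := by
    rw [CFC.rpow_rpow_of_exponent_nonneg a _ _ (by norm_num) (by norm_num) ha]
    norm_num
  rw [← h, rpow_half_mul_self CFC.rpow_nonneg]

theorem rpow_half_eq_of_mul_self_eq {a b : B} (hb : 0 ≤ b) (h : b * b = a) :
    a ^ (1 / 2 : ℝ) = b := by
  rw [← CFC.sqrt_eq_rpow, CFC.sqrt_unique h hb]

end Powers

/-- If `‖P x‖ ≤ c ‖B x‖`, then the assignment `B x ↦ P x` extends to the closure of the range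
of `B`. -/
theorem exists_tendsto_of_norm_le {E F G : Type*} [NormedAddCommGroup E] [NormedSpace ℂ E]
    [NormedAddCommGroup F] [NormedSpace ℂ F] [NormedAddCommGroup G] [NormedSpace ℂ G]
    [CompleteSpace G] (B : E →L[ℂ] F) (P : E →L[ℂ] G) {c : ℝ}
    (hc : ∀ x, ‖P x‖ ≤ c * ‖B x‖) {m : F} (hm : m ∈ closure (Set.range B)) :
    ∃ (u : ℕ → E) (w : G), Tendsto (fun n => B (u n)) atTop (𝓝 m) ∧
      Tendsto (fun n => P (u n)) atTop (𝓝 w) := by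
  obtain ⟨v, hv, hlim⟩ := mem_closure_iff_seq_limit.1 hm
  choose u hu using hv
  obtain rfl : v = fun n => B (u n) := funext fun n => (hu n).symm
  have hC : CauchySeq fun n => P (u n) := by
    rw [Metric.cauchySeq_iff']
    intro ε hε
    -- `|c| + 1` is a positive divisor whatever the sign of `c`.
    obtain ⟨N, hN⟩ := Metric.cauchySeq_iff'.1 hlim.cauchySeq (ε / (|c| + 1)) (by positivity)
    refine ⟨N, fun n hn => ?_⟩
    have h1 := hN n hn
    rw [dist_eq_norm, ← map_sub] at h1 ⊢
    calc ‖P (u n - u N)‖ ≤ c * ‖B (u n - u N)‖ := hc _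
      _ ≤ (|c| + 1) * ‖B (u n - u N)‖ := by
        gcongr
        linarith [le_abs_self c]
      _ < (|c| + 1) * (ε / (|c| + 1)) := by gcongr
      _ = ε := by field_simp
  obtain ⟨w, hw⟩ := cauchySeq_tendsto_of_complete hC
  exact ⟨u, w, hlim, hw⟩

variable {A E : Type*} [NonUnitalCStarAlgebra A] [PartialOrder A] [StarOrderedRing A]
  [NormedAddCommGroup E] [NormedSpace ℂ E] [SMul A E] [CStarModule A E]

theorem mul_val_apply (S T : L A E) (x : E) : (S * T).1 x = S.1 (T.1 x) := rfl

theorem inner_apply_comm {T : L A E} (hT : IsSelfAdjoint T) (x y : E) :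
    ⟪T.1 x, y⟫_A = ⟪x, T.1 y⟫_A := by
  rw [inner_star, hT.star_eq]

theorem range_mul_le (S T : L A E) : range (S * T) ≤ range S := by
  rintro _ ⟨x, rfl⟩
  exact ⟨T.1 x, rfl⟩

theorem apply_eq_zero_of_mul_self {T : L A E} (hT : IsSelfAdjoint T) {x : E}
    (h : (T * T).1 x = 0) : T.1 x = 0 := by
  rw [← CStarModule.inner_self (A := A), inner_apply_comm hT, ← mul_val_apply, h,
    CStarModule.inner_zero_right]

theorem norm_apply_sq {T : L A E} (hT : IsSelfAdjoint T) (x : E) :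
    ‖T.1 x‖ ^ 2 = ‖⟪x, (T * T).1 x⟫_A‖ := by
  rw [CStarModule.norm_sq_eq A, inner_apply_comm hT, mul_val_apply]

/-! ### Self-adjoint operators with dense range -/

section DenseRange

variable {h : L A E}

theorem denseRange_of_topologicalClosure (hd : (range h).topologicalClosure = ⊤) :
    DenseRange h.1 := by
  intro x
  have : x ∈ (range h).topologicalClosure := hd ▸ Submodule.mem_top
  exact this

theorem injective_of_denseRange (hsa : IsSelfAdjoint h) (hd : DenseRange h.1) :
    Function.Injective h.1 := by
  refine (injective_iff_map_eq_zero h.1).2 fun x hx => ?_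
  rw [← CStarModule.inner_self (A := A)]
  refine hd.induction_on (p := fun z => ⟪x, z⟫_A = 0) x
    (isClosed_eq ((CStarModule.continuous_inner (A := A) (E := E)).comp
      (continuous_const.prodMk continuous_id)) continuous_const) fun y => ?_
  rw [← inner_apply_comm hsa, hx, CStarModule.inner_zero_left]

theorem eq_of_mul_eq_mul_left (hi : Function.Injective h.1) {S T : L A E} (e : h * S = h * T) :
    S = T :=
  Subtype.ext (ContinuousLinearMap.ext fun x => hi (congrArg (fun R : L A E => R.1 x) e))

theorem eq_of_mul_eq_mul_right (hd : DenseRange h.1) {S T : L A E} (e : S * h = T * h) :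
    S = T := by
  refine Subtype.ext (ContinuousLinearMap.ext fun x => ?_)
  exact hd.induction_on (p := fun z => S.1 z = T.1 z) x
    (isClosed_eq S.1.continuous T.1.continuous) fun y => congrArg (fun R : L A E => R.1 y) e

/-- The form of `X` at `h y` is the form of `h * X * h` at `y`; density and closedness of the
positive cone do the rest. -/
theorem nonneg_of_conjugate_nonneg (hsa : IsSelfAdjoint h) (hd : DenseRange h.1) {X : L A E}
    (hX : 0 ≤ h * X * h) : 0 ≤ X := by
  refine nonneg_def.2 fun x => ?_
  refine hd.induction_on (p := fun z => 0 ≤ ⟪z, X.1 z⟫_A) x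
    (IsClosed.preimage ((CStarModule.continuous_inner (A := A) (E := E)).comp
      (continuous_id.prodMk X.1.continuous)) (CStarAlgebra.isClosed_nonneg (A := A))) fun y => ?_
  rw [inner_apply_comm hsa]
  exact nonneg_def.1 hX y

theorem norm_le_of_forall_norm_inner_le (hd : DenseRange h.1) {x : E} {c : ℝ} (hc0 : 0 ≤ c)
    (hc : ∀ y, ‖⟪x, h.1 y⟫_A‖ ≤ c * ‖h.1 y‖) : ‖x‖ ≤ c := by
  have hx : ‖⟪x, x⟫_A‖ ≤ c * ‖x‖ :=
    hd.induction_on (p := fun z => ‖⟪x, z⟫_A‖ ≤ c * ‖z‖) x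
      (isClosed_le ((CStarModule.continuous_inner (A := A) (E := E)).comp
        (continuous_const.prodMk continuous_id)).norm (by fun_prop)) hc
  rw [← norm_sq_eq' (A := A)] at hx
  rcases (norm_nonneg x).eq_or_lt with h0 | h0
  · rwa [← h0]
  · exact le_of_mul_le_mul_right hx h0

/-- Douglas factorization through a self-adjoint operator with dense range. -/
theorem exists_mul_eq_of_range_le [CompleteSpace E] (hsa : IsSelfAdjoint h)
    (hd : DenseRange h.1) {S : L A E} (hr : range S ≤ range h) : ∃ D : L A E, h * D = S := by
  have hi := injective_of_denseRange hsa hd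
  have hex : ∀ x, ∃ y, h.1 y = S.1 x := fun x => hr ⟨x, rfl⟩
  choose d hD using hex
  let f : E →ₗ[ℂ] E :=
    { toFun := d
      map_add' := fun x y => hi (by simp [hD])
      map_smul' := fun c x => hi (by simp [hD]) }
  have hf : ∀ x, h.1 (f x) = S.1 x := hD
  -- Closed graph theorem: limits are compared after applying the injective `h`.
  have hcont : Continuous f := f.continuous_of_seq_closed_graph fun u x y hu hy => hi (by
    rw [hf]
    refine tendsto_nhds_unique ((h.1.continuous.tendsto y).comp hy) ?_
    refine ((S.1.continuous.tendsto x).comp hu).congr fun n => ?_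
    exact (hf (u n)).symm)
  let D : E →L[ℂ] E := ⟨f, hcont⟩
  have hDS : ∀ x, h.1 (D x) = S.1 x := hf
  -- The adjoint of `D` is forced to send `h y` to `S* y`. `hbound` makes this assignment bounded,
  -- so it extends from the dense range of `h` to all of `E`.
  have hadj : ∀ x y, ⟪D x, h.1 y⟫_A = ⟪x, (star S).1 y⟫_A := fun x y => by
    rw [← inner_apply_comm hsa, hDS, inner_star]
  have hbound : ∀ y, ‖(star S).1 y‖ ≤ ‖D‖ * ‖h.1 y‖ := by
    intro y
    rcases (norm_nonneg ((star S).1 y)).eq_or_lt with h0 | h0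
    · rw [← h0]; positivity
    · refine le_of_mul_le_mul_left ?_ h0
      rw [norm_sq_eq' (A := A), ← hadj]
      calc _ ≤ ‖D ((star S).1 y)‖ * ‖h.1 y‖ := CStarModule.norm_inner_le E
        _ ≤ (‖D‖ * ‖(star S).1 y‖) * ‖h.1 y‖ := by gcongr; exact D.le_opNorm _
        _ = _ := by ring
  have hDadj : HasAdjoint A D := by
    have hw : ∀ y, ∃ w, ∀ x, ⟪D x, y⟫_A = ⟪x, w⟫_A := by
      intro y
      obtain ⟨u, w, hu, hw⟩ := exists_tendsto_of_norm_le h.1 (star S).1 hbound (hd y)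
      refine ⟨w, fun x => ?_⟩
      have hcx : ∀ z : E, Continuous fun v : E => ⟪z, v⟫_A := fun z =>
        (CStarModule.continuous_inner (A := A) (E := E)).comp
          (continuous_const.prodMk continuous_id)
      refine tendsto_nhds_unique (((hcx (D x)).tendsto y).comp hu) ?_
      exact (((hcx x).tendsto w).comp hw).congr fun n => (hadj x (u n)).symm
    choose w hw using hw
    exact ⟨w, fun x y => hw y x⟩
  exact ⟨⟨D, hDadj⟩, Subtype.ext (ContinuousLinearMap.ext hDS)⟩

/-- The closure of the range of `h* = h` is everything and its kernel is zero, so `h†` is the plain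
inverse on the range of `h`. -/
theorem mem_mpGraph_iff (hsa : IsSelfAdjoint h) (hd : DenseRange h.1) (p : E × E) :
    p ∈ mpGraph h ↔ p.1 = h.1 p.2 := by
  have hi := injective_of_denseRange hsa hd
  change (p.2 ∈ closure (Set.range (star h).1) ∧ (star h).1 (p.1 - h.1 p.2) = 0) ↔ _
  rw [hsa.star_eq, map_eq_zero_iff _ hi, sub_eq_zero]
  exact and_iff_right (hd _)

theorem toPMap_eq_pmul_mpInv (hsa : IsSelfAdjoint h) (hd : DenseRange h.1) {D S : L A E}
    (e : h * D = S) : toPMap D = pmul (mpInv h) S := by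
  have hg : ∀ x, (S.1 x, D.1 x) ∈ (mpInv h).graph := fun x => by
    rw [mpInv_graph, mem_mpGraph_iff hsa hd, ← e]
    rfl
  refine LinearPMap.ext ?_ ?_
  · refine (Submodule.eq_top_iff'.2 fun x => ?_).symm
    exact (LinearPMap.mem_domain_of_mem_graph (hg x) : S.1 x ∈ (mpInv h).domain)
  · intro x hx hx'
    exact LinearPMap.mem_graph_snd_inj (mpInv h) (hg x)
      ((mpInv h).mem_graph ⟨S.1 x, hx'⟩) rfl

end DenseRange

theorem adjRange_toPMap (D : L A E) : adjRange A (toPMap D) = range (star D) := by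
  ext z
  constructor
  · rintro ⟨p, hp, rfl⟩
    refine ⟨p.1, ext_inner (A := A) fun x => ?_⟩
    exact (inner_star D x p.1).symm.trans (hp ⟨x, Submodule.mem_top⟩)
  · rintro ⟨y, rfl⟩
    exact ⟨(y, (star D).1 y), fun x => inner_star D x y, rfl⟩

/-! ### Factorizations attached to the equation -/

section Riccati

variable {h K : L A E}

theorem mul_mul_mul_eq_of_sq_eq (hsa : IsSelfAdjoint h) (hd : DenseRange h.1) {X : L A E}
    (e : h * X * h * (h * X * h) = h * K * h) : X * (h * h) * X = K := by
  refine eq_of_mul_eq_mul_left (injective_of_denseRange hsa hd)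
    (eq_of_mul_eq_mul_right hd ?_)
  rw [← e]
  noncomm_ring

/-- Orthogonality to `G (G n)` gives `G n = 0`; a self-adjoint operator has the same kernel as its
square, so this descends through both roots. -/
theorem apply_quarter_eq_zero [CompleteSpace E] {G : L A E} (hG : 0 ≤ G) {n : E}
    (hn : n ∈ orth A (range G).topologicalClosure) : (G ^ (1 / 4 : ℝ)).1 n = 0 := by
  have hGn : G.1 n = 0 := by
    rw [← CStarModule.inner_self (A := A), inner_apply_comm (IsSelfAdjoint.of_nonneg hG)]
    exact hn _ (Submodule.le_topologicalClosure _ ⟨G.1 n, rfl⟩)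
  refine apply_eq_zero_of_mul_self (IsSelfAdjoint.of_nonneg CFC.rpow_nonneg) ?_
  rw [rpow_quarter_mul_self hG]
  refine apply_eq_zero_of_mul_self (IsSelfAdjoint.of_nonneg CFC.rpow_nonneg) ?_
  rwa [rpow_half_mul_self hG]

theorem norm_apply_le_of_mul_self_le {Q : L A E} (hQ : IsSelfAdjoint Q) (hsa : IsSelfAdjoint h)
    {c : ℝ} (hc : 0 < c) (hle : Q * Q ≤ c • (h * h)) (y : E) : ‖Q.1 y‖ ≤ √c * ‖h.1 y‖ := by
  have h1 : ⟪y, (Q * Q).1 y⟫_A ≤ (c : ℂ) • ⟪y, (h * h).1 y⟫_A := by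
    have h2 := le_def.1 hle y
    have h3 : (c • (h * h) - Q * Q).1 y = (c : ℂ) • (h * h).1 y - (Q * Q).1 y := rfl
    rwa [h3, CStarModule.inner_sub_right, CStarModule.inner_smul_right_complex,
      sub_nonneg] at h2
  have h0 : 0 ≤ ⟪y, (Q * Q).1 y⟫_A := by
    rw [mul_val_apply, ← inner_apply_comm hQ]
    exact CStarModule.inner_self_nonneg
  have h2 := CStarAlgebra.norm_le_norm_of_nonneg_of_le h0 h1
  rw [norm_smul, ← norm_apply_sq hQ, ← norm_apply_sq hsa] at h2
  refine abs_le_of_sq_le_sq' ?_ (by positivity) |>.2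
  rw [mul_pow, Real.sq_sqrt hc.le]
  simpa [abs_of_pos hc] using h2

theorem range_quarter_le [CompleteSpace E] {G : L A E} (hG : 0 ≤ G) (hsa : IsSelfAdjoint h)
    (hd : DenseRange h.1) (hC : OrthComplemented A (range G).topologicalClosure)
    (hr : range (G ^ (1 / 2 : ℝ)) ≤ range h) {c : ℝ} (hc : 0 < c)
    (hle : G ^ (1 / 2 : ℝ) ≤ c • (h * h)) : range (G ^ (1 / 4 : ℝ)) ≤ range h := by
  obtain ⟨D, hD⟩ := exists_mul_eq_of_range_le hsa hd hr
  have hQQ := rpow_quarter_mul_self hG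
  have hQ : IsSelfAdjoint (G ^ (1 / 4 : ℝ)) := IsSelfAdjoint.of_nonneg CFC.rpow_nonneg
  have hker : ∀ n ∈ orth A (range G).topologicalClosure, (G ^ (1 / 4 : ℝ)).1 n = 0 :=
    fun n => apply_quarter_eq_zero hG
  have hGQ : range G ≤ range (G ^ (1 / 4 : ℝ)) := by
    have : G = G ^ (1 / 4 : ℝ) * (G ^ (1 / 4 : ℝ) * G ^ (1 / 2 : ℝ)) := by
      rw [← mul_assoc, hQQ, rpow_half_mul_self hG]
    rw [this]
    -- The previous rewrite also expanded the `G` inside the power; this restores it.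
    nth_rewrite 2 [← this]
    exact range_mul_le _ _
  rw [← hQQ] at hD hle
  generalize G ^ (1 / 4 : ℝ) = Q at *
  have hDQ : ∀ x, h.1 (D.1 x) = Q.1 (Q.1 x) := fun x => congrArg (fun R : L A E => R.1 x) hD
  -- Test `D x` against the dense vectors `h y`: `⟨D x, h y⟩ = ⟨Q x, Q y⟩`.
  have hbound : ∀ x, ‖D.1 x‖ ≤ √c * ‖Q.1 x‖ := fun x =>
    norm_le_of_forall_norm_inner_le hd (by positivity) fun y => by
      rw [← inner_apply_comm hsa, hDQ, inner_apply_comm hQ]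
      calc _ ≤ ‖Q.1 x‖ * ‖Q.1 y‖ := CStarModule.norm_inner_le E
        _ ≤ ‖Q.1 x‖ * (√c * ‖h.1 y‖) := by
          gcongr; exact norm_apply_le_of_mul_self_le hQ hsa hc hle y
        _ = _ := by ring
  rintro _ ⟨x, rfl⟩
  -- Complementation enters here: `Q n = 0`, so only `Q m` needs a preimage under `h`, and `m` lies
  -- in the closure of the range of `Q`.
  obtain ⟨m, hm, n, hn, rfl⟩ := Submodule.mem_sup.1
    (hC.sup_eq_top.symm ▸ Submodule.mem_top : x ∈ _ ⊔ _)
  obtain ⟨u, w, hu, hw⟩ := exists_tendsto_of_norm_le Q.1 D.1 hbound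
    (Submodule.topologicalClosure_mono hGQ hm)
  refine ⟨w, ?_⟩
  change h.1 w = Q.1 (m + n)
  rw [map_add, hker n hn, add_zero]
  refine tendsto_nhds_unique ((h.1.continuous.tendsto w).comp hw) ?_
  exact ((Q.1.continuous.tendsto m).comp hu).congr fun k => (hDQ (u k)).symm

end Riccati

end HilbertModule

/-! ### The equivalence theorem -/

open HilbertModule in
theorem theorem2 {A E : Type*} [NonUnitalCStarAlgebra A] [PartialOrder A] [StarOrderedRing A]
    [NormedAddCommGroup E] [NormedSpace ℂ E] [CompleteSpace E] [SMul A E] [CStarModule A E]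
    (H K : L A E) (hH : 0 ≤ H) (hK : 0 ≤ K) (hns : Nonsingular H)
    (hC : OrthComplemented A
      (range (H ^ (1 / 2 : ℝ) * K * H ^ (1 / 2 : ℝ))).topologicalClosure) :
    (range ((H ^ (1 / 2 : ℝ) * K * H ^ (1 / 2 : ℝ)) ^ (1 / 2 : ℝ)) ≤ range (H ^ (1 / 2 : ℝ)) →
      ∃ D : L A E, toPMap D =
        pmul (mpInv (H ^ (1 / 2 : ℝ))) ((H ^ (1 / 2 : ℝ) * K * H ^ (1 / 2 : ℝ)) ^ (1 / 2 : ℝ))) ∧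
    List.TFAE [
      ∃ X : L A E, 0 ≤ X ∧ X * H * X = K,
      range ((H ^ (1 / 2 : ℝ) * K * H ^ (1 / 2 : ℝ)) ^ (1 / 2 : ℝ)) ≤ range (H ^ (1 / 2 : ℝ)) ∧
        adjRange A (pmul (mpInv (H ^ (1 / 2 : ℝ)))
          ((H ^ (1 / 2 : ℝ) * K * H ^ (1 / 2 : ℝ)) ^ (1 / 2 : ℝ))) ≤ range (H ^ (1 / 2 : ℝ)),
      range ((H ^ (1 / 2 : ℝ) * K * H ^ (1 / 2 : ℝ)) ^ (1 / 4 : ℝ)) ≤ range (H ^ (1 / 2 : ℝ)),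
      range ((H ^ (1 / 2 : ℝ) * K * H ^ (1 / 2 : ℝ)) ^ (1 / 2 : ℝ)) ≤ range (H ^ (1 / 2 : ℝ)) ∧
        ∃ c : ℝ, 0 < c ∧ (H ^ (1 / 2 : ℝ) * K * H ^ (1 / 2 : ℝ)) ^ (1 / 2 : ℝ) ≤ c • H] := by
  have hh := rpow_half_mul_self hH
  have h0 : 0 ≤ H ^ (1 / 2 : ℝ) := CFC.rpow_nonneg
  have hsa : IsSelfAdjoint (H ^ (1 / 2 : ℝ)) := .of_nonneg h0
  have hd : DenseRange (H ^ (1 / 2 : ℝ)).1 := by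
    refine denseRange_of_topologicalClosure (top_le_iff.1 (hns.2 ▸ ?_))
    refine Submodule.topologicalClosure_mono ?_
    nth_rewrite 1 [← hh]
    exact range_mul_le _ _
  generalize H ^ (1 / 2 : ℝ) = h at *
  subst hh
  have hG : 0 ≤ h * K * h := by
    simpa only [hsa.star_eq] using star_left_conjugate_nonneg hK h
  have hSS := rpow_half_mul_self hG
  have hQQ := rpow_quarter_mul_self hG
  have hS0 : 0 ≤ (h * K * h) ^ (1 / 2 : ℝ) := CFC.rpow_nonneg
  have hSsa : IsSelfAdjoint ((h * K * h) ^ (1 / 2 : ℝ)) := .of_nonneg hS0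
  have hQsa : IsSelfAdjoint ((h * K * h) ^ (1 / 4 : ℝ)) := .of_nonneg CFC.rpow_nonneg
  have hroot : ∀ X : L A E, 0 ≤ X → X * (h * h) * X = K →
      (h * K * h) ^ (1 / 2 : ℝ) = h * X * h := fun X hX e =>
    rpow_half_eq_of_mul_self_eq
      (by simpa only [hsa.star_eq] using star_left_conjugate_nonneg hX h)
      (by rw [← e]; noncomm_ring)
  have hsol : ∀ X : L A E, 0 ≤ X → (h * K * h) ^ (1 / 2 : ℝ) = h * X * h →
      ∃ X : L A E, 0 ≤ X ∧ X * (h * h) * X = K := fun X hX e =>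
    ⟨X, hX, mul_mul_mul_eq_of_sq_eq hsa hd (by rw [← e, hSS])⟩
  refine ⟨fun hr => ?_, ?_⟩
  · obtain ⟨D, hD⟩ := exists_mul_eq_of_range_le hsa hd hr
    exact ⟨D, toPMap_eq_pmul_mpInv hsa hd hD⟩
  tfae_have 1 → 2 := by
    rintro ⟨X, hX, e⟩
    have hS := hroot X hX e
    have hD : h * (X * h) = (h * K * h) ^ (1 / 2 : ℝ) := by rw [hS, mul_assoc]
    refine ⟨hD ▸ range_mul_le _ _, ?_⟩
    rw [← toPMap_eq_pmul_mpInv hsa hd hD, adjRange_toPMap, star_mul, hsa.star_eq]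
    exact range_mul_le _ _
  tfae_have 1 → 4 := by
    rintro ⟨X, hX, e⟩
    have hS := hroot X hX e
    -- The added `1` keeps the scalar positive when `X = 0`.
    refine ⟨?_, ‖X‖ + 1, by positivity, ?_⟩
    · rw [hS, mul_assoc]
      exact range_mul_le _ _
    · have h1 := CStarAlgebra.star_left_conjugate_le_norm_smul (a := h) (b := X) (.of_nonneg hX)
      rw [hsa.star_eq] at h1
      rw [hS, add_smul, one_smul]
      exact h1.trans (le_add_of_nonneg_right hH)
  tfae_have 4 → 3 := by
    rintro ⟨hr, c, hc, hle⟩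
    exact range_quarter_le hG hsa hd hC hr hc hle
  tfae_have 3 → 1 := by
    intro hr
    obtain ⟨C, e⟩ := exists_mul_eq_of_range_le hsa hd hr
    refine hsol (C * star C) (mul_star_self_nonneg C) ?_
    have e' : star C * h = (h * K * h) ^ (1 / 4 : ℝ) := by
      rw [← hQsa.star_eq, ← e, star_mul, hsa.star_eq]
    rw [← hQQ]
    nth_rewrite 1 [← e]
    rw [← e']
    noncomm_ring
  tfae_have 2 → 1 := by
    rintro ⟨hr, hr'⟩
    obtain ⟨D, hD⟩ := exists_mul_eq_of_range_le hsa hd hr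
    rw [← toPMap_eq_pmul_mpInv hsa hd hD, adjRange_toPMap] at hr'
    obtain ⟨X, hX⟩ := exists_mul_eq_of_range_le hsa hd hr'
    have e : (h * K * h) ^ (1 / 2 : ℝ) = h * X * h := by
      rw [hX, ← hSsa.star_eq, ← hD, star_mul, hsa.star_eq]
    exact hsol X (nonneg_of_conjugate_nonneg hsa hd (e ▸ hS0)) e
  tfae_finish
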